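/- Let $\lambda>0$, $T>0$, $\Omega>0$ and $\nu\ge 0$. Put $\mathcal M_\lambda(x)=x-2\lambda\lfloor (x+\lambda)/(2\lambda)\rfloor$, $f_s=1/T$, $B=\Omega/(2\pi)$ and $\mathrm{OF}=f_s/(2B)$. Let $g\in \mathrm{PW}_\Omega$, that is, $g:\mathbb R\to\mathbb R$ is a (continuous) real signal of finite energy whose Fourier transform vanishes outside $[-\Omega,\Omega]$, with $\|g\|_\infty<\infty$. Let the sampling times be $t_k=kT+\mu_k$, $k\in\mathbb Z$, with $|\mu_k|\le \nu T$ for all $k$. Let $\gamma[k]=g(t_k)$, let $\eta[k]$ be a bounded real noise sequence, and let $y_\eta[k]=\mathcal M_\lambda(\gamma[k]+\eta[k])$. Put $\rho=\|g\|_\infty/\lambda$ and $\rho_\eta=\|\eta\|_\infty/\lambda$. The second-order recovery scheme RSoD takes $y_\eta$, $\lambda$ and a bound $\beta_g\ge\|g\|_\infty$. With $(\Delta x)[k]=x[k+1]-x[k]$ and the anti-difference $(\mathrm S x)[k]=\sum_{m=1}^{k-1}x[m]$ for $k\ge 1$ (so $(\mathrm Sx)[1]=0$), continued to $k\le 0$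 by $(\mathrm S x)[k]=-\sum_{m=k}^{0}x[m]$, and with $\lfloor\cdot\rceil$ denoting rounding to the nearest integer, it computes $$r=\mathcal M_\lambda(\Delta^2y_\eta)-\Delta^2y_\eta,\qquad J=\Bigl\lceil 4\Bigl(\frac{\beta_g}{\lambda}+1\Bigr)\Bigr\rceil,\qquad \kappa=\Bigl\lfloor \frac{(\mathrm S^2r)[1]-(\mathrm S^2r)[J+1]}{2J\lambda}+\frac12\Bigr\rfloor,$$ $$s[k]=2\lambda\Bigl\lfloor\frac{(\mathrm S r)[k]}{2\lambda}\Bigr\rceil+2\lambda\kappa,\qquad \tilde\gamma[k]=(\mathrm S s)[k]+y_\eta[k]+2m_0\lambda,$$ where $m_0\in\mathbb Z$ is arbitrary. (i) If $$\rho\bigl((T\Omega)^2+4\nu T\Omega\bigr)+4\rho_\eta<1,\qquad(\ast)$$ then for every $\beta_g\ge\|g\|_\infty$ there is an integer $c$ such that, for every choice of $m_0$, the output is $\tilde\gamma[k]=\gamma[k]+\eta[k]+2m\lambda$ for all $k\in\mathbb Z$, with $m=m_0+c$ independent of $k$. That is, $\gamma+\eta$ is recovered exactly up to a global multiple of $2\lambda$.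 (ii) If $\rho>0$ and $\rho_\eta<\frac14$, then $(\ast)$ is equivalent to $$T\Omega<-2\nu+\sqrt{4\nu^2+\frac{1-4\rho_\eta}{\rho}},$$ and also to $$\mathrm{OF}>\frac{\pi}{-2\nu+\sqrt{4\nu^2+\frac{1-4\rho_\eta}{\rho}}}.$$ -/

import Mathlib

open MeasureTheory
open scoped FourierTransform

noncomputable section

/-- Membership in the Paley-Wiener space `PW_Ω`: `g` is (the continuous representative of) a real
signal of finite energy whose Fourier transform vanishes outside `[-Ω, Ω]`. The transform is the
one on `L²(ℝ)`; Mathlib's frequency variable `ξ` is in hertz, the angular frequency is `2 π ξ`. -/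
structure IsPaleyWiener (Ω : ℝ) (g : ℝ → ℝ) : Prop where
  continuous : Continuous g
  memLp : MemLp (fun t : ℝ => (g t : ℂ)) 2 volume
  bandlimited : ∀ᵐ ξ : ℝ, Ω < |2 * Real.pi * ξ| →
    (𝓕 (memLp.toLp (fun t : ℝ => (g t : ℂ))) : Lp ℂ 2 (volume : Measure ℝ)) ξ = 0

/-- The sup norm of a function or sequence (used for bounded ones only). -/
def supNorm {ι : Type*} (f : ι → ℝ) : ℝ := ⨆ i, |f i|

/-- The modulo operation `M_l`, folding a real number into `[-l, l)`. -/
def modFold (l x : ℝ) : ℝ := x - 2 * l * (⌊(x + l) / (2 * l)⌋ : ℝ)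

/-- The anti-difference operator: `(S x)[k] = ∑_{m=1}^{k-1} x[m]` for `k ≥ 1` (so `(S x)[1] = 0`),
continued to `k ≤ 0` by `(S x)[k] = -∑_{m=k}^{0} x[m]`. In either case one of the two sums is
empty. It is the inverse of the forward difference on the sequences that vanish at `1`. -/
def antiDiff (x : ℤ → ℝ) (k : ℤ) : ℝ := ∑ m ∈ Finset.Ico 1 k, x m - ∑ m ∈ Finset.Ico k 1, x m

/-- The oversampling factor `f_s / (2 B)`, with `f_s = 1 / T` and `B = Ω / (2 π)`. -/
def oversamplingFactor (T Ω : ℝ) : ℝ := (1 / T) / (2 * (Ω / (2 * Real.pi)))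

namespace RSoD

/-- The candidate second difference of the residue: `M_l(Δ² y) - Δ² y`. -/
def resDiff (l : ℝ) (y : ℤ → ℝ) (k : ℤ) : ℝ :=
  modFold l ((fwdDiff (1 : ℤ))^[2] y k) - (fwdDiff (1 : ℤ))^[2] y k

/-- The block length `J = ⌈4 (β / l + 2 ^ (N - 2))⌉` for `N = 2`. -/
def blockLength (l β : ℝ) : ℤ := ⌈4 * (β / l + 1)⌉

/-- The integer `κ` that fixes the constant lost in the first anti-difference. -/
def kappa (l β : ℝ) (y : ℤ → ℝ) : ℤ :=
  ⌊(antiDiff (antiDiff (resDiff l y)) 1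
      - antiDiff (antiDiff (resDiff l y)) (blockLength l β + 1))
    / (2 * (blockLength l β : ℝ) * l) + 1 / 2⌋

/-- The first anti-difference, rounded to `2 l ℤ` and corrected by `2 l κ`. -/
def firstDiff (l β : ℝ) (y : ℤ → ℝ) (k : ℤ) : ℝ :=
  2 * l * (round (antiDiff (resDiff l y) k / (2 * l)) : ℝ) + 2 * l * (kappa l β y : ℝ)

/-- The output `γ̃` of the second-order difference recovery (RSoD) on noisy modulo samples `y`,
with threshold `l` and amplitude prior `β`. The free integer `m` in the last step is an
argument. -/
def recover (l β : ℝ) (y : ℤ → ℝ) (m : ℤ) (k : ℤ) : ℝ :=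
  antiDiff (firstDiff l β y) k + y k + 2 * (m : ℝ) * l

end RSoD

end

/-! Write `z = γ + η` and `ε = z - y`, a sequence in `2λℤ`. Folding is `2λ`-periodic, so if `|Δ²z| <
λ` then folding `Δ²y = Δ²z - Δ²ε` gives `Δ²z`, and `r = Δ²ε` exactly. Summing twice recovers `ε` up
to two constants: a slope, which `κ` detects because `ε` is bounded while a wrong slope would drift
linearly, and an offset, which is the unavoidable multiple of `2λ`. The condition `(∗)` is what
forces `|Δ²z| < λ`. Bernstein's inequality bounds `g''` by `Ω²‖g‖∞` for the uniform grid and `g'` by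
`Ω‖g‖∞` for the jitter; the noise adds at most `4‖η‖∞`. Bernstein with the sharp constant comes from
M. Riesz' interpolation formula, that is, from the Fourier series of the triangle wave. -/

/-! ### Riesz interpolation and Bernstein's inequality. -/

section Bernstein

/-- The Fourier series of the triangle wave. -/
theorem hasSum_sin_odd_div_sq {u : ℝ} (hu : |u| ≤ Real.pi / 2) :
    HasSum (fun n : ℕ => (-1 : ℝ) ^ n / (2 * n + 1) ^ 2 * Real.sin ((2 * n + 1) * u))
      (Real.pi * u / 4) := by
  have hπ := Real.pi_pos
  obtain ⟨h1, h2⟩ := abs_le.mp hu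
  -- Chosen so that `cos (2π(2n+1)x) = (-1)^n sin ((2n+1)u)`. The bound on `u` puts `x` and `2x` in
  -- `[0, 1]`, where the series of the second Bernoulli polynomial holds.
  set x : ℝ := 1 / 4 - u / (2 * Real.pi) with hx
  have hux : u / (2 * Real.pi) ≤ 1 / 4 := by rw [div_le_iff₀ (by positivity)]; linarith
  have hux' : -(1 / 4) ≤ u / (2 * Real.pi) := by rw [le_div_iff₀ (by positivity)]; linarith
  have hall := hasSum_one_div_nat_pow_mul_cos one_ne_zero (x := x)
    ⟨by linarith, by linarith⟩
  have hdbl := hasSum_one_div_nat_pow_mul_cos one_ne_zero (x := 2 * x)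
    ⟨by linarith, by linarith⟩
  have hB (z : ℝ) : (Polynomial.map (algebraMap ℚ ℝ) (Polynomial.bernoulli (2 * 1))).eval z
      = z ^ 2 - z + 6⁻¹ := bernoulliFun_two z
  rw [hB] at hall hdbl
  set f : ℕ → ℝ := fun n => 1 / (n : ℝ) ^ (2 * 1) * Real.cos (2 * Real.pi * n * x) with hf
  -- The even terms at `x` form a quarter of the series at `2x`; subtracting them leaves the odd
  -- ones.
  have heven := hdbl.mul_left (1 / 4)
  have heven' : HasSum (fun n => f (2 * n)) (1 / 4 * ((-1) ^ (1 + 1) * (2 * Real.pi) ^ (2 * 1) / 2 /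
      ((2 * 1).factorial : ℝ) * ((2 * x) ^ 2 - 2 * x + 6⁻¹))) := by
    convert! heven using 2 with n
    simp only [hf]
    push_cast
    rw [show 2 * Real.pi * (2 * (n : ℝ)) * x = 2 * Real.pi * n * (2 * x) by ring, mul_pow,
      one_div_mul_eq_div, one_div_mul_eq_div]
    rw [show (2 : ℝ) ^ (2 * 1) = 4 by norm_num, mul_comm (4 : ℝ), ← div_div]
    ring
  have hodd : Summable (fun n => f (2 * n + 1)) :=
    hall.summable.comp_injective fun a b h => by simpa using h
  have hsum := (heven'.even_add_odd hodd.hasSum).unique hall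
  convert! hodd.hasSum using 1
  · ext n
    simp only [hf]
    have : 2 * Real.pi * ((2 * n + 1 : ℕ) : ℝ) * x
        = (Real.pi / 2 - (2 * n + 1) * u) + n * Real.pi := by
      rw [hx]; push_cast; field_simp; ring
    rw [this, Real.cos_add_nat_mul_pi, Real.cos_pi_div_two_sub]
    push_cast
    ring
  · rw [← eq_sub_iff_add_eq'] at hsum
    rw [hsum]
    simp [Nat.factorial, hx]
    field_simp
    ring

theorem hasSum_one_div_odd_sq :
    HasSum (fun n : ℕ => 1 / (2 * (n : ℝ) + 1) ^ 2) (Real.pi ^ 2 / 8) := by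
  have h := hasSum_sin_odd_div_sq (u := Real.pi / 2) (by rw [abs_of_pos (by positivity)])
  convert! h using 1
  · ext n
    rw [show (2 * (n : ℝ) + 1) * (Real.pi / 2) = Real.pi / 2 + n * Real.pi by ring,
      Real.sin_add_nat_mul_pi, Real.sin_pi_div_two, mul_one, div_mul_eq_mul_div, ← pow_add,
      Even.neg_one_pow ⟨n, rfl⟩]
  · ring

/-- Integrands of the terms of M. Riesz' interpolation formula sum up to the integrand of the
derivative. -/
theorem hasSum_riesz_interpolation_char {Ω : ℝ} (hΩ : 0 < Ω) {v : ℝ}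
    (hv : |2 * Real.pi * v| ≤ Ω) (t : ℝ) :
    HasSum (fun n : ℕ => ((4 * Ω / Real.pi ^ 2 * ((-1) ^ n / (2 * n + 1) ^ 2) : ℝ) : ℂ) *
        (Real.fourierChar (-(v * (t + (2 * n + 1) * (Real.pi / (2 * Ω))))) -
          Real.fourierChar (-(v * (t - (2 * n + 1) * (Real.pi / (2 * Ω)))))))
      (-2 * Real.pi * Complex.I * v * Real.fourierChar (-(v * t))) := by
  have hπ := Real.pi_pos
  -- The node spacing maps the band onto `|u| ≤ π/2`, where the triangle wave is linear and so
  -- reproduces the multiplier of the derivative.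
  set u : ℝ := 2 * Real.pi * v * (Real.pi / (2 * Ω)) with hu
  have hu' : |u| ≤ Real.pi / 2 := by
    rw [hu, abs_mul, abs_of_pos (by positivity : 0 < Real.pi / (2 * Ω))]
    calc _ ≤ Ω * (Real.pi / (2 * Ω)) := by gcongr
      _ = _ := by field_simp
  have h := (Complex.hasSum_ofReal.mpr (hasSum_sin_odd_div_sq hu')).mul_left
    (((4 * Ω / Real.pi ^ 2 : ℝ) : ℂ) * (-2 * Complex.I) * Real.fourierChar (-(v * t)))
  convert! h using 1
  · ext n
    have e1 (s : ℝ) : ((Real.fourierChar (-(v * (t + s))) : Circle) : ℂ) =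
        Real.fourierChar (-(v * t)) * Complex.exp (-((2 * Real.pi * v * s : ℝ) : ℂ) * Complex.I) := by
      rw [Real.fourierChar_apply, Real.fourierChar_apply, ← Complex.exp_add]
      congr 1; push_cast; ring
    have e2 : 2 * Real.pi * v * ((2 * n + 1) * (Real.pi / (2 * Ω))) = (2 * n + 1) * u := by
      rw [hu]; ring
    rw [sub_eq_add_neg t, e1, e1, mul_neg, e2, Complex.ofReal_mul _ (Real.sin _),
      Complex.ofReal_sin, Complex.sin, Complex.ofReal_mul (_ / _)]
    have := Complex.I_mul_I
    rw [Complex.ofReal_neg, neg_neg]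
    generalize Complex.exp (_ * Complex.I) = a
    generalize Complex.exp (_ * Complex.I) = b
    linear_combination (((4 * Ω / Real.pi ^ 2 : ℝ) : ℂ) * (((-1) ^ n / (2 * n + 1) ^ 2 : ℝ) : ℂ)
      * Real.fourierChar (-(v * t)) * (a - b)) * this
  · rw [hu]; push_cast
    have : (Real.pi : ℂ) ≠ 0 := by exact_mod_cast hπ.ne'
    have : (Ω : ℂ) ≠ 0 := by exact_mod_cast hΩ.ne'
    field_simp

/-- Licenses differentiation under the Fourier integral: `v` is bounded on the band. -/
theorem integrable_mul_of_bandlimited {Ω : ℝ} {G : ℝ → ℂ}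
    (hG : Integrable G) (hb : ∀ᵐ v : ℝ, Ω < |2 * Real.pi * v| → G v = 0) :
    Integrable fun v : ℝ => v • G v := by
  refine (hG.norm.const_mul (|Ω|/ (2 * Real.pi))).mono'
    (continuous_id.aestronglyMeasurable.smul hG.1) ?_
  filter_upwards [hb] with v hv
  rcases lt_or_ge Ω |2 * Real.pi * v| with h | h
  · simp [hv h]
  · rw [norm_smul]
    gcongr
    rw [abs_mul, abs_of_pos Real.two_pi_pos] at h
    rw [le_div_iff₀ Real.two_pi_pos, Real.norm_eq_abs, mul_comm]
    exact h.trans (le_abs_self _)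

/-- **Bernstein's inequality**, for the Fourier transform of an integrable bandlimited function. -/
theorem norm_fourier_mul_le_of_bandlimited {Ω M : ℝ} (hΩ : 0 < Ω) {G : ℝ → ℂ}
    (hG : Integrable G) (hb : ∀ᵐ v : ℝ, Ω < |2 * Real.pi * v| → G v = 0)
    (hM : ∀ t, ‖𝓕 G t‖ ≤ M) (t : ℝ) :
    ‖𝓕 (fun v : ℝ => (-2 * Real.pi * Complex.I * v) • G v) t‖ ≤ Ω * M := by
  have hπ := Real.pi_pos
  set c : ℕ → ℝ := fun n => 4 * Ω / Real.pi ^ 2 * ((-1) ^ n / (2 * n + 1) ^ 2) with hc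
  set a : ℕ → ℝ := fun n => (2 * n + 1) * (Real.pi / (2 * Ω)) with ha
  have hcn (n : ℕ) : ‖(c n : ℂ)‖ = 4 * Ω / Real.pi ^ 2 * (1 / (2 * (n : ℝ) + 1) ^ 2) := by
    rw [Complex.norm_real, hc, Real.norm_eq_abs, abs_mul,
      abs_of_pos (by positivity : 0 < 4 * Ω / Real.pi ^ 2), abs_div, abs_pow, abs_neg, abs_one,
      one_pow, abs_of_pos (by positivity : 0 < (2 * (n : ℝ) + 1) ^ 2)]
  -- `4Ω/π² · π²/8 = Ω/2`; each coefficient multiplies a difference of two values, hence the sharp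
  -- constant `Ω`.
  have hcs : HasSum (fun n => ‖(c n : ℂ)‖) (Ω / 2) := by
    simp_rw [hcn]
    convert! hasSum_one_div_odd_sq.mul_left (4 * Ω / Real.pi ^ 2) using 1
    field_simp
    ring
  have hint (s : ℝ) : Integrable fun v => (Real.fourierChar (-(v * s)) : ℂ) * G v := by
    refine hG.mono ?_ (.of_forall fun v => by rw [norm_mul, Circle.norm_coe, one_mul])
    exact (by fun_prop : Continuous fun v : ℝ =>
      ((Real.fourierChar (-(v * s)) : Circle) : ℂ)).aestronglyMeasurable.mul hG.1
  have hF (s : ℝ) : 𝓕 G s = ∫ v, (Real.fourierChar (-(v * s)) : ℂ) * G v := by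
    rw [Real.fourier_real_eq]; rfl
  have key : HasSum (fun n => (c n : ℂ) * (𝓕 G (t + a n) - 𝓕 G (t - a n)))
      (𝓕 (fun v : ℝ => (-2 * Real.pi * Complex.I * v) • G v) t) := by
    have := hasSum_integral_of_dominated_convergence (μ := volume)
      (F := fun n v => (c n : ℂ) * ((Real.fourierChar (-(v * (t + a n))) : ℂ) * G v -
        (Real.fourierChar (-(v * (t - a n))) : ℂ) * G v))
      (f := fun v => Real.fourierChar (-(v * t)) • (-2 * Real.pi * Complex.I * v) • G v)
      (fun n v => ‖(c n : ℂ)‖ * (2 * ‖G v‖))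
      (fun n => (((hint _).sub (hint _)).const_mul _).1) ?_ ?_ ?_ ?_
    · rw [Real.fourier_real_eq]
      convert! this using 2 with n
      rw [integral_const_mul, integral_sub (hint _) (hint _), hF, hF]
    · intro n
      refine .of_forall fun v => ?_
      rw [norm_mul]
      gcongr
      refine (norm_sub_le _ _).trans ?_
      rw [norm_mul, norm_mul, Circle.norm_coe, Circle.norm_coe]
      linarith
    · exact .of_forall fun v => hcs.summable.mul_right _
    · simp_rw [tsum_mul_right]
      exact (hG.norm.const_mul 2).const_mul _
    · filter_upwards [hb] with v hv
      rcases lt_or_ge Ω |2 * Real.pi * v| with h | h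
      · simp [hv h, hasSum_zero]
      · convert! (hasSum_riesz_interpolation_char hΩ h t).mul_right (G v) using 1
        · ext n; simp only [hc, ha]; ring
        · rw [Circle.smul_def, smul_eq_mul, smul_eq_mul]; ring
  rw [← key.tsum_eq]
  have hbound := hcs.mul_right (2 * M)
  refine (tsum_of_norm_bounded hbound fun n => ?_).trans (by linarith)
  rw [norm_mul]
  gcongr
  exact (norm_sub_le _ _).trans (by linarith [hM (t + a n), hM (t - a n)])

end Bernstein

/-! ### Paley-Wiener signals: Fourier representation, derivatives, second differences. -/

section PaleyWiener

open scoped ContDiff in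
/-- An `L²` function whose `L²` Fourier transform is integrable is almost everywhere the inverse
Fourier integral of that transform. -/
theorem ae_eq_fourierInv_of_integrable (f : Lp ℂ 2 (volume : Measure ℝ))
    (hF : Integrable ((𝓕 f : Lp ℂ 2 (volume : Measure ℝ)) : ℝ → ℂ)) :
    (f : ℝ → ℂ) =ᵐ[volume] 𝓕⁻ ((𝓕 f : Lp ℂ 2 (volume : Measure ℝ)) : ℝ → ℂ) := by
  set F : Lp ℂ 2 (volume : Measure ℝ) := 𝓕 f with hFdef
  have hcont : Continuous (𝓕⁻ (F : ℝ → ℂ)) := by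
    simpa [FourierTransformInv.fourierInv] using! VectorFourier.fourierIntegral_continuous
      (L := -innerₗ ℝ) Real.continuous_fourierChar continuous_inner.neg hF
  refine ae_eq_of_integral_contDiff_smul_eq ((Lp.memLp f).locallyIntegrable (by norm_num))
    hcont.locallyIntegrable fun φ hφ hφc => ?_
  have h₁ : HasCompactSupport (Complex.ofRealCLM ∘ φ) := hφc.comp_left rfl
  have h₂ : ContDiff ℝ ∞ (Complex.ofRealCLM ∘ φ) := by fun_prop
  set ψ := h₁.toSchwartzMap h₂ with hψ
  have hψφ (x : ℝ) : ψ x = (φ x : ℂ) := rfl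
  -- The `L²` inversion, read as an identity of tempered distributions; integrability of `F` then
  -- lets the transform move back off `ψ`.
  have h3 : (f : SchwartzMap ℝ ℂ →Lₚₜ[ℂ] ℂ) ψ = (F : SchwartzMap ℝ ℂ →Lₚₜ[ℂ] ℂ) (𝓕⁻ ψ) := by
    have := Lp.fourierInv_toTemperedDistribution_eq F
    rw [hFdef, FourierTransform.fourierInv_fourier_eq] at this
    rw [← this]
    rfl
  rw [Lp.toTemperedDistribution_apply, Lp.toTemperedDistribution_apply] at h3
  have h4 : ∫ x, (𝓕⁻ ψ) x • F x = ∫ x, ψ x • 𝓕⁻ (F : ℝ → ℂ) x := by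
    have := VectorFourier.integral_fourierIntegral_smul_eq_flip (L := -innerₗ ℝ)
      Real.continuous_fourierChar continuous_inner.neg (ψ.integrable (μ := volume)) hF
    have hflip : (-innerₗ ℝ).flip = -innerₗ ℝ := by
      ext; simp
    rw [hflip] at this
    simpa only [SchwartzMap.fourierInv_coe] using! this
  rw [h4] at h3
  simpa [hψφ] using! h3

/-- A Paley-Wiener signal is the Fourier transform of an integrable bandlimited function. -/
theorem IsPaleyWiener.exists_fourier_eq {Ω : ℝ} {g : ℝ → ℝ} (hg : IsPaleyWiener Ω g) :
    ∃ G : ℝ → ℂ, Integrable G ∧ (∀ᵐ v : ℝ, Ω < |2 * Real.pi * v| → G v = 0) ∧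
      ∀ t, 𝓕 G t = (g t : ℂ) := by
  set F : Lp ℂ 2 (volume : Measure ℝ) := 𝓕 (hg.memLp.toLp (fun t : ℝ => (g t : ℂ))) with hFdef
  have hF : Integrable (F : ℝ → ℂ) := by
    have : IntegrableOn (F : ℝ → ℂ) (Set.Icc (-(Ω / (2 * Real.pi))) (Ω / (2 * Real.pi))) :=
      ((Lp.memLp F).restrict _).integrable (by norm_num)
    refine this.integrable_of_ae_notMem_eq_zero ?_
    filter_upwards [hg.bandlimited] with v hv hvn
    refine hv ?_
    contrapose! hvn
    rw [Set.mem_Icc, ← abs_le, le_div_iff₀ Real.two_pi_pos]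
    rwa [abs_mul, abs_of_pos Real.two_pi_pos, mul_comm] at hvn
  -- The reflection turns the inverse transform into a forward one.
  refine ⟨fun v => F (-v), hF.comp_neg, ?_, ?_⟩
  · have := (Measure.measurePreserving_neg (volume : Measure ℝ)).quasiMeasurePreserving.ae
      hg.bandlimited
    filter_upwards [this] with v hv h
    exact hv (by rwa [mul_neg, abs_neg])
  · rw [← Real.fourierInv_eq_fourier_comp_neg]
    have hcont : Continuous (𝓕⁻ (F : ℝ → ℂ)) := by
      simpa [FourierTransformInv.fourierInv] using! VectorFourier.fourierIntegral_continuous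
        (L := -innerₗ ℝ) Real.continuous_fourierChar continuous_inner.neg hF
    have h := (ae_eq_fourierInv_of_integrable _ hF).symm.trans hg.memLp.coeFn_toLp
    have hc : Continuous fun t => (g t : ℂ) := Complex.continuous_ofReal.comp hg.continuous
    exact congrFun ((hcont.ae_eq_iff_eq volume hc).mp h)

/-- **Bernstein's inequality** for the first two derivatives of a bounded Paley-Wiener signal. -/
theorem IsPaleyWiener.exists_deriv_bounds {Ω M : ℝ} (hΩ : 0 < Ω) {g : ℝ → ℝ}
    (hg : IsPaleyWiener Ω g) (hM : ∀ t, |g t| ≤ M) :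
    ∃ g₁ g₂ : ℝ → ℂ, (∀ t, HasDerivAt (fun s => (g s : ℂ)) (g₁ t) t) ∧
      (∀ t, HasDerivAt g₁ (g₂ t) t) ∧ (∀ t, ‖g₁ t‖ ≤ Ω * M) ∧ ∀ t, ‖g₂ t‖ ≤ Ω ^ 2 * M := by
  obtain ⟨G, hG, hb, hGg⟩ := hg.exists_fourier_eq
  have hfun : (fun s => (g s : ℂ)) = 𝓕 G := (funext hGg).symm
  set G₁ : ℝ → ℂ := fun v => (-2 * Real.pi * Complex.I * v) • G v with hG₁
  have hvG := integrable_mul_of_bandlimited hG hb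
  have hG₁i : Integrable G₁ := by
    refine (hvG.const_mul (-2 * Real.pi * Complex.I)).congr (.of_forall fun v => ?_)
    simp only [hG₁, Complex.real_smul, smul_eq_mul]
    ring
  have hb₁ : ∀ᵐ v : ℝ, Ω < |2 * Real.pi * v| → G₁ v = 0 := by
    filter_upwards [hb] with v hv h
    simp [hG₁, hv h]
  have hM₁ := norm_fourier_mul_le_of_bandlimited hΩ hG hb (M := M) fun t => by
    rw [hGg, Complex.norm_real]; exact hM t
  refine ⟨_, _, fun t => hfun ▸ Real.hasDerivAt_fourier hG hvG t,
    fun t => Real.hasDerivAt_fourier hG₁i (integrable_mul_of_bandlimited hG₁i hb₁) t, hM₁,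
    fun t => ?_⟩
  have := norm_fourier_mul_le_of_bandlimited hΩ hG₁i hb₁ hM₁ t
  rwa [← mul_assoc, ← sq] at this

/-- Second differences of a bounded Paley-Wiener signal at jittered samples. -/
theorem IsPaleyWiener.abs_second_difference_le {Ω M T δ : ℝ} (hΩ : 0 < Ω) (hT : 0 < T)
    {g : ℝ → ℝ} (hg : IsPaleyWiener Ω g) (hM : ∀ t, |g t| ≤ M) (a μ₀ μ₁ μ₂ : ℝ)
    (h₀ : |μ₀| ≤ δ) (h₁ : |μ₁| ≤ δ) (h₂ : |μ₂| ≤ δ) :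
    |g (a + 2 * T + μ₂) - 2 * g (a + T + μ₁) + g (a + μ₀)|
      ≤ M * ((T * Ω) ^ 2 + 4 * δ * Ω) := by
  obtain ⟨g₁, g₂, hd₁, hd₂, hb₁, hb₂⟩ := hg.exists_deriv_bounds hΩ hM
  have lip (x m : ℝ) (hm : |m| ≤ δ) : |g (x + m) - g x| ≤ Ω * M * δ := by
    have h := convex_univ.norm_image_sub_le_of_norm_hasDerivWithin_le
      (fun t _ => (hd₁ t).hasDerivWithinAt) (fun t _ => hb₁ t) (Set.mem_univ x)
      (Set.mem_univ (x + m))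
    rw [← Complex.ofReal_sub, Complex.norm_real, add_sub_cancel_left] at h
    exact h.trans (mul_le_mul_of_nonneg_left hm ((norm_nonneg _).trans (hb₁ 0)))
  have hd₁' (t : ℝ) (c : ℝ) : HasDerivAt (fun s => (g (s + c) : ℂ)) (g₁ (t + c)) t :=
    (hd₁ (t + c)).comp_add_const t c
  have hb (t : ℝ) : ‖g₁ (t + T) - g₁ t‖ ≤ Ω ^ 2 * M * T := by
    have h := convex_univ.norm_image_sub_le_of_norm_hasDerivWithin_le
      (fun t _ => (hd₂ t).hasDerivWithinAt) (fun t _ => hb₂ t) (Set.mem_univ t)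
      (Set.mem_univ (t + T))
    rwa [add_sub_cancel_left, Real.norm_eq_abs, abs_of_pos hT] at h
  -- Mean value inequality for `s ↦ g (s + T) - g s`, whose derivative is at most `Ω²MT` by `hb`.
  -- The jitter then enters with weights 1, 2, 1, giving `4δΩM`.
  have hsecond : |(g (a + T + T) - g (a + T)) - (g (a + T) - g a)| ≤ Ω ^ 2 * M * T * T := by
    have h := convex_univ.norm_image_sub_le_of_norm_hasDerivWithin_le
      (fun t _ => ((hd₁' t T).sub (hd₁ t)).hasDerivWithinAt) (fun t _ => hb t) (Set.mem_univ a)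
      (Set.mem_univ (a + T))
    rw [add_sub_cancel_left, Real.norm_eq_abs T, abs_of_pos hT] at h
    simpa [← Complex.ofReal_sub, Complex.norm_real] using! h
  have l₀ := abs_le.mp (lip a μ₀ h₀)
  have l₁ := abs_le.mp (lip (a + T) μ₁ h₁)
  have l₂ := abs_le.mp (lip (a + 2 * T) μ₂ h₂)
  rw [show a + T + T = a + 2 * T by ring] at hsecond
  have l₃ := abs_le.mp hsecond
  rw [abs_le]
  constructor <;> nlinarith

end PaleyWiener

/-! ### Exact recovery of the residue, and the oversampling condition. -/

section Recovery

theorem abs_le_supNorm {ι : Type*} {f : ι → ℝ} (hf : BddAbove (Set.range fun i => |f i|)) (i : ι) :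
    |f i| ≤ supNorm f :=
  le_ciSup hf i

theorem antiDiff_fwdDiff (x : ℤ → ℝ) (k : ℤ) : antiDiff (fwdDiff 1 x) k = x k - x 1 := by
  unfold antiDiff
  rcases le_total 1 k with h | h
  · rw [Finset.Ico_eq_empty_of_le h, Finset.sum_empty, sub_zero]
    induction k, h using Int.leInduction with
    | base => simp
    | succ k hk ih =>
      rw [← Finset.insert_Ico_right_eq_Ico_add_one hk, Finset.sum_insert (by simp), ih, fwdDiff]
      ring
  · rw [Finset.Ico_eq_empty_of_le h, Finset.sum_empty, zero_sub]
    induction k, h using Int.leInductionDown with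
    | base => simp
    | pred k hk ih =>
      rw [← Finset.insert_Ico_add_one_left_eq_Ico (by lia : k - 1 < 1), Finset.sum_insert (by simp),
        sub_add_cancel, neg_add, ih, fwdDiff, sub_add_cancel]
      ring

theorem fwdDiff_iterate_two (x : ℤ → ℝ) (k : ℤ) :
    (fwdDiff (1 : ℤ))^[2] x k = x (k + 2) - 2 * x (k + 1) + x k := by
  simp only [Function.iterate_succ, Function.iterate_zero, Function.comp, id, fwdDiff, add_assoc,
    one_add_one_eq_two]
  ring

theorem modFold_sub_mul_int {l : ℝ} (hl : 0 < l) {w : ℝ} (hw : |w| < l) (n : ℤ) :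
    modFold l (w - 2 * l * n) = w := by
  obtain ⟨h₁, h₂⟩ := abs_lt.mp hw
  have : ⌊(w - 2 * l * n + l) / (2 * l)⌋ = -n := by
    rw [Int.floor_eq_iff, le_div_iff₀ (by positivity), div_lt_iff₀ (by positivity)]
    push_cast
    constructor <;> nlinarith
  rw [modFold, this]
  push_cast
  ring

theorem abs_modFold_le {l : ℝ} (hl : 0 < l) (x : ℝ) : |modFold l x| ≤ l := by
  have h₁ := Int.floor_le ((x + l) / (2 * l))
  have h₂ := Int.lt_floor_add_one ((x + l) / (2 * l))
  rw [le_div_iff₀ (by positivity)] at h₁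
  rw [div_lt_iff₀ (by positivity)] at h₂
  rw [modFold, abs_le]
  constructor <;> linarith

namespace RSoD

theorem recover_eq_of_abs_second_difference_lt {l β : ℝ} (hl : 0 < l) (hβ : 0 ≤ β) {z y : ℤ → ℝ}
    (hy : ∀ k, y k = modFold l (z k)) (hz : ∀ k, |z k| ≤ β + l / 4)
    (hΔ : ∀ k, |z (k + 2) - 2 * z (k + 1) + z k| < l) :
    ∃ c : ℤ, ∀ m k : ℤ, recover l β y m k = z k + 2 * ((m + c : ℤ) : ℝ) * l := by
  set e : ℤ → ℤ := fun k => ⌊(z k + l) / (2 * l)⌋ with he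
  set ε : ℤ → ℝ := fun k => 2 * l * e k with hε
  have hyz (k : ℤ) : y k = z k - ε k := by rw [hy]; rfl
  have hres : resDiff l y = fwdDiff 1 (fwdDiff 1 ε) := by
    ext k
    have h₁ : (fwdDiff (1 : ℤ))^[2] y k = (z (k + 2) - 2 * z (k + 1) + z k)
        - 2 * l * ((e (k + 2) - 2 * e (k + 1) + e k : ℤ) : ℝ) := by
      rw [fwdDiff_iterate_two, hyz, hyz, hyz]
      simp only [hε]
      push_cast
      ring
    have h₂ : fwdDiff 1 (fwdDiff 1 ε) k = ε (k + 2) - 2 * ε (k + 1) + ε k :=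
      fwdDiff_iterate_two ε k
    rw [resDiff, h₁, modFold_sub_mul_int hl (hΔ k), h₂]
    simp only [hε]
    push_cast
    ring
  -- The constant lost in the first anti-difference, in units of `2l`; the second turns it into the
  -- linear drift `-(k - 1) * q`.
  set q : ℤ := e 2 - e 1 with hq
  have hS (k : ℤ) : antiDiff (resDiff l y) k = 2 * l * ((e (k + 1) - e k - q : ℤ) : ℝ) := by
    rw [hres, antiDiff_fwdDiff]
    simp only [fwdDiff, hε, hq, one_add_one_eq_two]
    push_cast
    ring
  have hSS (k : ℤ) : antiDiff (antiDiff (resDiff l y)) k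
      = 2 * l * (e k - e 1 - (k - 1) * q) := by
    have : antiDiff (resDiff l y) = fwdDiff 1 fun k : ℤ => 2 * l * ((e k : ℝ) - k * q) := by
      ext k
      rw [hS, fwdDiff]
      push_cast
      ring
    rw [this, antiDiff_fwdDiff]
    push_cast
    ring
  set J : ℤ := blockLength l β with hJ
  have hJle : 4 * (β / l + 1) ≤ J := Int.le_ceil _
  have hJl : 4 * (β + l) ≤ J * l := by
    have := mul_le_mul_of_nonneg_right hJle hl.le
    rwa [mul_assoc, add_mul, div_mul_cancel₀ _ hl.ne', one_mul] at this
  have hJpos : (0 : ℝ) < J := lt_of_lt_of_le (by positivity) hJle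
  have hεb (k : ℤ) : |ε k| ≤ β + l / 4 + l := by
    have h₁ : ε k = z k - y k := by rw [hyz]; ring
    rw [h₁]
    refine (abs_sub _ _).trans (add_le_add (hz k) ?_)
    rw [hy]
    exact abs_modFold_le hl _
  have hκ : kappa l β y = q := by
    rw [kappa, hSS, hSS, ← hJ, Int.floor_eq_iff]
    have h₁ := abs_le.mp (hεb 1)
    have h₂ := abs_le.mp (hεb (J + 1))
    simp only [hε] at h₁ h₂
    have hden : 0 < 2 * (J : ℝ) * l := by positivity
    have hsplit : (2 * l * (e 1 - e 1 - (((1 : ℤ) : ℝ) - 1) * q)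
        - 2 * l * (e (J + 1) - e 1 - (((J + 1 : ℤ) : ℝ) - 1) * q)) / (2 * J * l) + 1 / 2
        = q + (1 / 2 - (2 * l * e (J + 1) - 2 * l * e 1) / (2 * J * l)) := by
      push_cast
      field_simp
      ring
    rw [hsplit]
    -- The two values of `ε` differ by at most `2β + 5l/2 < 4(β + l) ≤ Jl`, so the error stays
    -- strictly below `1/2` and the floor returns `q`.
    have h₃ : (2 * l * e (J + 1) - 2 * l * e 1) / (2 * J * l) < 1 / 2 := by
      rw [div_lt_iff₀ hden]; linarith
    have h₄ : -(1 / 2) < (2 * l * e (J + 1) - 2 * l * e 1) / (2 * J * l) := by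
      rw [lt_div_iff₀ hden]; linarith
    constructor <;> linarith
  have hfirst : firstDiff l β y = fwdDiff 1 ε := by
    ext k
    rw [firstDiff, hS, hκ, mul_div_cancel_left₀ _ (by positivity), round_intCast, fwdDiff]
    simp only [hε]
    push_cast
    ring
  -- The second anti-difference returns `ε k - ε 1`; the lost `ε 1` is the global offset.
  refine ⟨-e 1, fun m k => ?_⟩
  rw [recover, hfirst, antiDiff_fwdDiff, hyz]
  simp only [hε]
  push_cast
  ring

end RSoD

/-- Complete the square: `x² + 4νx = (x + 2ν)² - 4ν²`, with `x + 2ν` positive. -/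
theorem mul_sq_add_lt_iff_lt_sqrt {r s ν x : ℝ} (hr : 0 < r) (hν : 0 ≤ ν) (hx : 0 < x) :
    r * (x ^ 2 + 4 * ν * x) + 4 * s < 1 ↔
      x < -2 * ν + Real.sqrt (4 * ν ^ 2 + (1 - 4 * s) / r) := by
  rw [show (x < -2 * ν + Real.sqrt (4 * ν ^ 2 + (1 - 4 * s) / r)) ↔
      x + 2 * ν < Real.sqrt (4 * ν ^ 2 + (1 - 4 * s) / r) by constructor <;> intro h <;> linarith,
    Real.lt_sqrt (by positivity), ← sub_lt_iff_lt_add', lt_div_iff₀ hr]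
  constructor <;> intro h <;> linarith

end Recovery
theorem theorem2
    (l T Ω ν : ℝ) (hl : 0 < l) (hT : 0 < T) (hΩ : 0 < Ω) (hν : 0 ≤ ν)
    (g : ℝ → ℝ) (hg : IsPaleyWiener Ω g) (hgb : BddAbove (Set.range fun s => |g s|))
    (t μ : ℤ → ℝ) (ht : ∀ k, t k = (k : ℝ) * T + μ k) (hμ : ∀ k, |μ k| ≤ ν * T)
    (η : ℤ → ℝ) (hη : BddAbove (Set.range fun k => |η k|))
    (γ y : ℤ → ℝ) (hγ : ∀ k, γ k = g (t k)) (hy : ∀ k, y k = modFold l (γ k + η k))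
    (ρ ρη : ℝ) (hρ : ρ = supNorm g / l) (hρη : ρη = supNorm η / l) :
    -- recovery up to a global multiple of `2 l`
    (ρ * ((T * Ω) ^ 2 + 4 * ν * (T * Ω)) + 4 * ρη < 1 →
      ∀ β : ℝ, supNorm g ≤ β →
        ∃ c : ℤ, ∀ m k : ℤ, RSoD.recover l β y m k = γ k + η k + 2 * ((m + c : ℤ) : ℝ) * l) ∧
    -- the two equivalent forms of the condition
    (0 < ρ → ρη < 1 / 4 →
      (ρ * ((T * Ω) ^ 2 + 4 * ν * (T * Ω)) + 4 * ρη < 1 ↔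
        T * Ω < -2 * ν + Real.sqrt (4 * ν ^ 2 + (1 - 4 * ρη) / ρ)) ∧
      (ρ * ((T * Ω) ^ 2 + 4 * ν * (T * Ω)) + 4 * ρη < 1 ↔
        Real.pi / (-2 * ν + Real.sqrt (4 * ν ^ 2 + (1 - 4 * ρη) / ρ))
          < oversamplingFactor T Ω)) := by
  have hx : 0 < T * Ω := mul_pos hT hΩ
  refine ⟨fun hcond β hβ => ?_, fun hρ0 hρη4 => ?_⟩
  · have hgM := abs_le_supNorm hgb
    have hηM := abs_le_supNorm hη
    have hβ0 : 0 ≤ β := (abs_nonneg _).trans ((hgM 0).trans hβ)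
    have hM0 : 0 ≤ supNorm g := (abs_nonneg _).trans (hgM 0)
    have hgl : ρ * l = supNorm g := by rw [hρ, div_mul_cancel₀ _ hl.ne']
    have hηl : ρη * l = supNorm η := by rw [hρη, div_mul_cancel₀ _ hl.ne']
    have hcond' : supNorm g * ((T * Ω) ^ 2 + 4 * (ν * T) * Ω) + 4 * supNorm η < l := by
      rw [← hgl, ← hηl]
      nlinarith
    have hη4 : supNorm η ≤ l / 4 := by
      have : 0 ≤ supNorm g * ((T * Ω) ^ 2 + 4 * (ν * T) * Ω) := by positivity
      linarith
    refine RSoD.recover_eq_of_abs_second_difference_lt hl hβ0 hy (fun k => ?_) fun k => ?_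
    · refine (abs_add_le _ _).trans (add_le_add ?_ ((hηM k).trans hη4))
      rw [hγ]
      exact (hgM _).trans hβ
    · have hsd := hg.abs_second_difference_le hΩ hT hgM (k * T) (μ k) (μ (k + 1)) (μ (k + 2))
        (hμ k) (hμ (k + 1)) (hμ (k + 2))
      have t₁ : (k : ℝ) * T + T + μ (k + 1) = t (k + 1) := by rw [ht]; push_cast; ring
      have t₂ : (k : ℝ) * T + 2 * T + μ (k + 2) = t (k + 2) := by rw [ht]; push_cast; ring
      rw [t₁, t₂, ← ht, ← hγ, ← hγ, ← hγ] at hsd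
      have h := abs_le.mp hsd
      have h₀ := abs_le.mp (hηM k)
      have h₁ := abs_le.mp (hηM (k + 1))
      have h₂ := abs_le.mp (hηM (k + 2))
      rw [abs_lt]
      constructor <;> linarith
  · have hiff := mul_sq_add_lt_iff_lt_sqrt (s := ρη) hρ0 hν hx
    refine ⟨hiff, hiff.trans ?_⟩
    -- This is where `ρη < 1/4` matters: a positive bound is needed to pass to reciprocals.
    have hD : 0 < -2 * ν + Real.sqrt (4 * ν ^ 2 + (1 - 4 * ρη) / ρ) := by
      have : 2 * ν < Real.sqrt (4 * ν ^ 2 + (1 - 4 * ρη) / ρ) := by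
        rw [Real.lt_sqrt (by positivity)]
        have : 0 < (1 - 4 * ρη) / ρ := div_pos (by linarith) hρ0
        linarith
      linarith
    have hOF : oversamplingFactor T Ω = Real.pi / (T * Ω) := by
      have := Real.pi_pos
      rw [oversamplingFactor]
      field_simp
    rw [hOF, div_lt_div_iff_of_pos_left Real.pi_pos hD hx]
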